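/- Let $p,m,k\ge 1$ be integers. For an integer $n\ge 0$, let $\mathcal H^{m,k}_{p,n}$ be the number of $k$-element subsets of $n$ objects arranged in a line such that the number of objects strictly between any two distinct selected ones is never one of $m-1,2m-1,\dots,pm-1$. Let $\mathcal G^{m,k}_{p,n}$ be the number of $k$-element subsets of $n$ objects arranged in a circle such that, for any two distinct selected objects, the number of objects strictly between them on either of the two arcs joining them is never one of $m-1,2m-1,\dots,pm-1$. For an integer $x$ (possibly negative) and an integer $r\ge 0$, write $\binom{x}{r}=\frac{x(x-1)\cdots(x-r+1)}{r!}$ (so $\binom{x}{0}=1$). (i) For every $n\ge pm(k-1)$, $$\mathcal H^{m,k}_{p,n}=\sum_{j=0}^{k}\binom{m+j-2}{j}\binom{n+mp+m-pk-1}{k-j}(-p-1)^j,$$ $$\mathcal H^{m,k}_{p,n}=\sum_{j=0}^{k}\binom{n+mp-(p+1)k+j}{j}\binom{n+mp+m-pk-1}{k-j}(p+1)^j(-p)^{k-j},$$ $$\mathcal H^{m,k}_{p,n}=\sum_{j=0}^{k-1}\frac{n-pj}{k}\binom{m+j-1}{j}\binom{n+mp+m-pk-1}{k-1-j}(-p-1)^j.$$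 (ii) For every $n\ge mpk+1$, $$\mathcal G^{m,k}_{p,n}=\frac{n}{n-pk}\binom{n-pk}{k}.$$ -/

import Mathlib

/-- The set of admissible separations: all naturals except `m - 1, 2 m - 1, …, p m - 1`
(used for `m ≥ 1`, so that the subtraction is the usual one). -/
def admissibleGaps (m p : ℕ) : Set ℕ :=
  {j | ∀ i : ℕ, 1 ≤ i → i ≤ p → j ≠ i * m - 1}

/-- A set `A` of objects, out of `n` objects in a line, is `N`-separate if the number of objects
strictly between any two distinct members of `A` belongs to `N`. -/
def IsLineSeparate {n : ℕ} (N : Set ℕ) (A : Finset (Fin n)) : Prop :=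
  ∀ a ∈ A, ∀ b ∈ A, a < b → (Finset.Ioo a b).card ∈ N

/-- For distinct objects `a`, `b` out of `n` objects placed in cyclic order `0, 1, …, n - 1` on a
circle: the number of objects strictly between `a` and `b` on the arc running in the direction of
increasing labels from `a` to `b`. -/
def arcCount {n : ℕ} (a b : Fin n) : ℕ :=
  if a < b then (Finset.Ioo a b).card else (Finset.Ioi a).card + (Finset.Iio b).card

/-- A set `A` of objects, out of `n` objects on a circle, is `N`-separate if, for any two distinct
members of `A`, the number of objects strictly between them belongs to `N`, on each of the two
arcs (`a` and `b` range over ordered pairs). -/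
def IsCircleSeparate {n : ℕ} (N : Set ℕ) (A : Finset (Fin n)) : Prop :=
  ∀ a ∈ A, ∀ b ∈ A, a ≠ b → arcCount a b ∈ N

open Classical in
/-- The number of separate `k`-subsets of `n` objects in a line. -/
noncomputable def lineCount (p m n k : ℕ) : ℕ :=
  ((Finset.powersetCard k (Finset.univ : Finset (Fin n))).filter
    (fun A => IsLineSeparate (admissibleGaps m p) A)).card

open Classical in
/-- The number of separate `k`-subsets of `n` objects on a circle. -/
noncomputable def circleCount (p m n k : ℕ) : ℕ :=
  ((Finset.powersetCard k (Finset.univ : Finset (Fin n))).filter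
    (fun A => IsCircleSeparate (admissibleGaps m p) A)).card

/-!
Both counts are numbers of independent sets for the relation "the distance is one of
`m, 2m, …, pm`". Stepping by `m` splits the line with `n` objects into `m` lines (the residue
classes mod `m`) and the circle into `gcd n m` circles of length `n / gcd n m`
(`indepSeries_line_eq_prod`, `indepSeries_circle_eq_pow`), on which the forbidden steps are
`1, …, p`. There the counts are classical: `choose (N + p - pk) k` on a line of length `N`, and
`choose (N - pk) k + p * choose (N - pk - 1) (k - 1)` on a circle of length `N`. It remains to
multiply the generating series of the pieces.

For this, let `separateSeries p m n` be the series whose `k`-th coefficient is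
`[X ^ k] (1 + X) ^ (n + pm + m - pk - 1) * (1 + (p + 1) X) ^ (1 - m)`, with `n` any integer. Its
coefficients for `m = 1` and `m = 0` are the counts on a short line and a short circle, as long as
`k` is not too large compared with the length. For every `m` it satisfies
`F n = F (n - 1) + X * F (n - p - 1)`. A solution of this recurrence over all integers `n` is
determined by a single value (`eq_zero_of_recurrence`), so that
`separateSeries p m (n + a) = separateSeries p 0 n * separateSeries p m a`. Together with the
relation `separateSeries_succ` between `m + 1` and `m` this gives
`∏ i < m, separateSeries p 1 (a i) = separateSeries p m (∑ i < m, a i)`. This takes the place of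
Lagrange inversion for the root `B` of `B ^ (p + 1) = B ^ p + X`, for which
`separateSeries p 0 n = B ^ n`.

Hence the line count is the `k`-th coefficient of `separateSeries p m n`, the circle count that of
`separateSeries p 0 n`. The three formulas for the line come from expanding the product directly,
from writing `1 + X = (1 + (p + 1) X) - p X`, and from differentiating the product.
-/

open PowerSeries

/-! ### Powers of linear series with integer exponents -/

/-- The integer power series `(1 + c X) ^ r`, for an arbitrary integer exponent `r`. -/
noncomputable def linearPow (c r : ℤ) : ℤ⟦X⟧ := rescale c (binomialSeries ℤ r)

lemma coeff_linearPow (c r : ℤ) (n : ℕ) :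
    coeff n (linearPow c r) = c ^ n * Ring.choose r n := by
  simp [linearPow, coeff_rescale]

lemma linearPow_add (c r s : ℤ) : linearPow c (r + s) = linearPow c r * linearPow c s := by
  simp [linearPow]

lemma linearPow_zero (c : ℤ) : linearPow c 0 = 1 := by
  simp [linearPow]

lemma linearPow_one (c : ℤ) : linearPow c 1 = 1 + C c * X := by
  have h := binomialSeries_nat (R := ℤ) (A := ℤ) 1
  rw [Nat.cast_one, pow_one] at h
  simp [linearPow, h, rescale_X]

lemma linearPow_eq_mul (c r : ℤ) : linearPow c r = linearPow c (r - 1) * (1 + C c * X) := by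
  rw [← linearPow_one, ← linearPow_add]
  congr 1
  ring

lemma succ_mul_choose_succ (r : ℤ) (n : ℕ) :
    ((n : ℤ) + 1) * Ring.choose r (n + 1) = r * Ring.choose (r - 1) n := by
  have h := Ring.choose_smul_choose r (n := n + 1) (k := 1) (by omega)
  simpa [Ring.choose_one_right] using h

lemma derivative_linearPow (c r : ℤ) :
    derivative ℤ (linearPow c r) = C (c * r) * linearPow c (r - 1) := by
  ext n
  rw [coeff_derivative, coeff_C_mul, coeff_linearPow, coeff_linearPow]
  linear_combination c ^ (n + 1) * succ_mul_choose_succ r n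

/-! ### The series governing lines and circles -/

/-- The generating series that, for `m ≥ 1`, governs the line with `n` objects and forbidden steps
`m, 2m, …, pm`, and for `m = 0` governs the circle. Its `k`-th coefficient is that of `X ^ k` in
`(1 + X) ^ (n + pm + m - pk - 1) * (1 + (p + 1) X) ^ (1 - m)`; since the exponent depends on `k`,
this is not itself a product of two power series. -/
noncomputable def separateSeries (p : ℤ) (m : ℕ) (n : ℤ) : ℤ⟦X⟧ :=
  mk fun k => coeff k (linearPow 1 (n + p * m + m - p * k - 1) * linearPow (p + 1) (1 - m))

lemma coeff_separateSeries (p : ℤ) (m : ℕ) (n : ℤ) (k : ℕ) :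
    coeff k (separateSeries p m n) =
      coeff k (linearPow 1 (n + p * m + m - p * k - 1) * linearPow (p + 1) (1 - m)) := by
  rw [separateSeries, coeff_mk]

lemma coeff_zero_separateSeries (p n : ℤ) (m : ℕ) : coeff 0 (separateSeries p m n) = 1 := by
  rw [coeff_separateSeries]
  simp [coeff_mul, coeff_linearPow]

lemma separateSeries_recurrence (p : ℤ) (m : ℕ) (n : ℤ) :
    separateSeries p m n = separateSeries p m (n - 1) + X * separateSeries p m (n - p - 1) := by
  ext k
  rw [map_add]
  cases k with
  | zero => simp only [coeff_zero_separateSeries, coeff_zero_X_mul, add_zero]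
  | succ k =>
    rw [coeff_succ_X_mul, coeff_separateSeries, coeff_separateSeries, coeff_separateSeries,
      ← coeff_succ_X_mul k, ← map_add, linearPow_eq_mul]
    congr 1
    rw [map_one, one_mul,
      show n - p - 1 + p * m + m - p * k - 1 = n - 1 + p * m + m - p * (k + 1 : ℕ) - 1 by
        push_cast; ring,
      show n + p * m + m - p * (k + 1 : ℕ) - 1 - 1 = n - 1 + p * m + m - p * (k + 1 : ℕ) - 1 by
        ring]
    ring

/-- A bi-infinite sequence of power series satisfying the recurrence `D n = D (n-1) + X D (n-p-1)`
is determined by any one of its members: modulo `X ^ (k+1)`, the differences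
`D n - D (n-1)` only depend on the sequence modulo `X ^ k`. -/
lemma eq_zero_of_recurrence (p : ℤ) (D : ℤ → ℤ⟦X⟧)
    (hD : ∀ n, D n = D (n - 1) + X * D (n - p - 1)) (h0 : D 0 = 0) (n : ℤ) : D n = 0 := by
  ext k
  rw [map_zero]
  induction k generalizing n with
  | zero =>
    have step : ∀ n, coeff 0 (D n) = coeff 0 (D (n - 1)) := fun n => by
      conv_lhs => rw [hD n]
      simp
    induction n using Int.induction_on with
    | zero => simp [h0]
    | succ i ih => rw [step, add_sub_cancel_right, ih]
    | pred i ih => rw [← step, ih]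
  | succ k ihk =>
    have step : ∀ n, coeff (k + 1) (D n) = coeff (k + 1) (D (n - 1)) := fun n => by
      conv_lhs => rw [hD n]
      rw [map_add, coeff_succ_X_mul, ihk, add_zero]
    induction n using Int.induction_on with
    | zero => simp [h0]
    | succ i ih => rw [step, add_sub_cancel_right, ih]
    | pred i ih => rw [← step, ih]

lemma separateSeries_zero_zero (p : ℤ) : separateSeries p 0 0 = 1 := by
  ext k
  cases k with
  | zero => rw [coeff_zero_separateSeries, coeff_zero_one]
  | succ k =>
    rw [coeff_separateSeries, Nat.cast_zero, sub_zero, linearPow_one, mul_add, mul_one, map_add,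
      mul_left_comm, coeff_C_mul, coeff_succ_mul_X, coeff_linearPow, coeff_linearPow, coeff_one,
      if_neg (by omega)]
    -- `(k+1) choose(a, k+1) = (a-k) choose(a, k)` at `a = -p(k+1) - 1`
    have h := Ring.choose_smul_choose (-p * (k + 1) - 1) (n := k + 1) (k := k)
      (by omega)
    rw [Nat.add_sub_cancel_left, Ring.choose_one_right, Nat.choose_succ_self_right,
      nsmul_eq_mul] at h
    have hk : ((k : ℤ) + 1) ≠ 0 := by positivity
    apply mul_left_cancel₀ hk
    rw [show 0 + p * 0 + 0 - p * (k + 1 : ℕ) - 1 = -p * (k + 1) - 1 by push_cast; ring]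
    simp only [one_pow, one_mul]
    push_cast at h
    linear_combination h

/-- Changing the length multiplies the series by one that does not depend on `m`. -/
lemma separateSeries_eq_mul (p : ℤ) (m : ℕ) (n a : ℤ) :
    separateSeries p m (n + a) = separateSeries p 0 n * separateSeries p m a := by
  rw [← sub_eq_zero]
  refine eq_zero_of_recurrence p
    (fun n => separateSeries p m (n + a) - separateSeries p 0 n * separateSeries p m a)
    (fun n => ?_) ?_ n
  · rw [separateSeries_recurrence p m (n + a), separateSeries_recurrence p 0 n,
      show n + a - 1 = n - 1 + a by ring, show n + a - p - 1 = n - p - 1 + a by ring]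
    ring
  · simp [separateSeries_zero_zero]

/-- The factor `(1 + p) (1 + X) - p` produced on the left is `1 + (p + 1) X`. -/
lemma separateSeries_succ (p : ℤ) (m : ℕ) (n : ℤ) :
    C (1 + p) * separateSeries p (m + 1) n - C p * separateSeries p (m + 1) (n - 1) =
      separateSeries p m (n + p) := by
  ext k
  rw [map_sub, coeff_C_mul, coeff_C_mul, coeff_separateSeries, coeff_separateSeries,
    coeff_separateSeries, ← coeff_C_mul, ← coeff_C_mul, ← map_sub]
  congr 1
  rw [linearPow_eq_mul 1 (n + p * (m + 1 : ℕ) + (m + 1 : ℕ) - p * k - 1),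
    linearPow_eq_mul (p + 1) (1 - m),
    show n - 1 + p * (m + 1 : ℕ) + (m + 1 : ℕ) - p * k - 1 =
      n + p + p * m + m - p * k - 1 by push_cast; ring,
    show n + p * (m + 1 : ℕ) + (m + 1 : ℕ) - p * k - 1 - 1 =
      n + p + p * m + m - p * k - 1 by push_cast; ring,
    show (1 : ℤ) - m - 1 = 1 - (m + 1 : ℕ) by push_cast; ring]
  simp only [map_add, map_one]
  ring

/-- Adjoining one more line of length `a`. -/
lemma separateSeries_succ_add (p : ℤ) (m : ℕ) (n a : ℤ) :
    separateSeries p (m + 1) (n + a) = separateSeries p m n * separateSeries p 1 a := by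
  -- both sides become `separateSeries p m (n + a + p)` after multiplication by `U`, whose
  -- constant coefficient is `1`
  set U : ℤ⟦X⟧ := C (1 + p) - C p * separateSeries p 0 (-1) with hU
  have hU0 : U ≠ 0 := by
    intro h
    have := congrArg (coeff 0) h
    rw [hU, map_sub, coeff_C_mul, coeff_zero_separateSeries, coeff_zero_C] at this
    simp at this
  have key : ∀ (m : ℕ) (n : ℤ), U * separateSeries p (m + 1) n = separateSeries p m (n + p) := by
    intro m n
    rw [← separateSeries_succ, show n - 1 = -1 + n by ring, separateSeries_eq_mul p _ (-1), hU]
    ring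
  apply mul_left_cancel₀ hU0
  rw [key, mul_left_comm, ← zero_add 1, key, add_assoc, add_comm n, separateSeries_eq_mul,
    mul_comm]

lemma prod_separateSeries_one (p : ℤ) {m : ℕ} (a : ℕ → ℤ) :
    ∏ i ∈ Finset.range m, separateSeries p 1 (a i) =
      separateSeries p m (∑ i ∈ Finset.range m, a i) := by
  induction m with
  | zero => simp [separateSeries_zero_zero]
  | succ m ih => rw [Finset.prod_range_succ, Finset.sum_range_succ, separateSeries_succ_add, ih]

lemma separateSeries_zero_pow (p : ℤ) (d : ℕ) (a : ℤ) :
    separateSeries p 0 a ^ d = separateSeries p 0 (d * a) := by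
  induction d with
  | zero => simp [separateSeries_zero_zero]
  | succ d ih => rw [pow_succ, ih, ← separateSeries_eq_mul]; congr 1; push_cast; ring

lemma coeff_separateSeries_one (p n : ℤ) (k : ℕ) :
    coeff k (separateSeries p 1 n) = Ring.choose (n + p - p * k) k := by
  rw [coeff_separateSeries, Nat.cast_one, sub_self, linearPow_zero, mul_one, coeff_linearPow,
    one_pow, one_mul]
  congr 1
  ring

lemma coeff_succ_separateSeries_zero (p n : ℤ) (k : ℕ) :
    coeff (k + 1) (separateSeries p 0 n) =
      Ring.choose (n - p * (k + 1)) (k + 1) + p * Ring.choose (n - p * (k + 1) - 1) k := by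
  rw [coeff_separateSeries, Nat.cast_zero, sub_zero, linearPow_one, mul_add, mul_one, map_add,
    mul_left_comm, coeff_C_mul, coeff_succ_mul_X, coeff_linearPow, coeff_linearPow]
  have h := Ring.choose_succ_succ (n - p * (k + 1) - 1) k
  rw [sub_add_cancel] at h
  rw [h, show n + p * 0 + 0 - p * (k + 1 : ℕ) - 1 = n - p * (k + 1) - 1 by push_cast; ring]
  ring

/-- The closed form `n / (n - pk) * choose (n - pk) k`, with the denominator cleared. -/
lemma mul_coeff_separateSeries_zero (p n : ℤ) (k : ℕ) :
    (n - p * k) * coeff k (separateSeries p 0 n) = n * Ring.choose (n - p * k) k := by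
  cases k with
  | zero => rw [coeff_zero_separateSeries]; simp
  | succ k =>
    rw [coeff_succ_separateSeries_zero]
    push_cast
    linear_combination -p * succ_mul_choose_succ (n - p * (k + 1)) k

/-! ### Expansions of the coefficients -/

lemma neg_pow_mul_choose (c r : ℤ) (j : ℕ) :
    Ring.choose (r + j - 1) j * (-c) ^ j = coeff j (linearPow c (-r)) := by
  rw [coeff_linearPow, Ring.choose_neg, Units.smul_def, smul_eq_mul, Int.coe_negOnePow_natCast,
    neg_pow]
  ring

lemma coeff_separateSeries_eq_sum (p : ℤ) (m k : ℕ) (n : ℤ) :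
    coeff k (separateSeries p m n) =
      ∑ j ∈ Finset.range (k + 1), Ring.choose ((m : ℤ) + j - 2) j
        * Ring.choose (n + m * p + m - p * k - 1) (k - j) * (-p - 1) ^ j := by
  rw [coeff_separateSeries, mul_comm, coeff_mul,
    Finset.Nat.sum_antidiagonal_eq_sum_range_succ_mk]
  refine Finset.sum_congr rfl fun j _ => ?_
  simp only
  rw [show (1 : ℤ) - m = -(m - 1) by ring, ← neg_pow_mul_choose, coeff_linearPow, one_pow,
    one_mul, show (m : ℤ) - 1 + j - 1 = m + j - 2 by ring, show -(p + 1) = -p - 1 by ring,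
    mul_comm p m]
  ring

/-- The expansion obtained from `1 + X = (1 + c X) + (1 - c) X`. -/
lemma coeff_one_mul_linearPow (c : ℤ) (y : ℕ) (s : ℤ) (k : ℕ) :
    coeff k (linearPow 1 y * linearPow c s) =
      ∑ j ∈ Finset.range (k + 1), Ring.choose (y + s - k + j) j * Ring.choose (y : ℤ) (k - j)
        * c ^ j * (1 - c) ^ (k - j) := by
  have expand : linearPow 1 y =
      ∑ i ∈ Finset.range (y + 1), C ((1 - c) ^ i * y.choose i) * X ^ i * linearPow c (y - i) := by
    have hpow : ∀ (c : ℤ) (e : ℕ), linearPow c e = (1 + C c * X) ^ e := by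
      intro c e
      rw [linearPow, binomialSeries_nat, map_pow, map_add, map_one, rescale_X]
    rw [hpow, show (1 : ℤ⟦X⟧) + C 1 * X = C (1 - c) * X + (1 + C c * X) by simp; ring, add_pow]
    refine Finset.sum_congr rfl fun i hi => ?_
    rw [← Nat.cast_sub (by simpa [Nat.lt_succ_iff] using hi), hpow]
    simp only [map_mul, map_pow, map_natCast, mul_pow]
    ring
  rw [expand, Finset.sum_mul, map_sum]
  have term : ∀ i : ℕ, coeff k (C ((1 - c) ^ i * (y.choose i : ℤ)) * X ^ i * linearPow c (y - i)
      * linearPow c s) = if i ≤ k then (1 - c) ^ i * y.choose i *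
        (c ^ (k - i) * Ring.choose (y + s - i) (k - i)) else 0 := by
    intro i
    rw [mul_assoc, ← linearPow_add, mul_assoc, coeff_C_mul, coeff_X_pow_mul']
    split_ifs
    · rw [coeff_linearPow, sub_add_eq_add_sub]
    · simp
  simp only [term]
  -- extend both sums to a common range; the extra terms vanish
  have h1 : ∑ i ∈ Finset.range (y + 1), (if i ≤ k then (1 - c) ^ i * (y.choose i : ℤ) *
        (c ^ (k - i) * Ring.choose (y + s - i) (k - i)) else 0) =
      ∑ i ∈ Finset.range (y + 1 + k), if i ≤ k then (1 - c) ^ i * (y.choose i : ℤ) *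
        (c ^ (k - i) * Ring.choose (y + s - i) (k - i)) else 0 := by
    refine Finset.sum_subset (Finset.range_mono (by omega)) fun i _ hi => ?_
    rw [Nat.choose_eq_zero_of_lt (by simpa using hi)]
    simp
  have h2 : ∑ i ∈ Finset.range (k + 1), (if i ≤ k then (1 - c) ^ i * (y.choose i : ℤ) *
        (c ^ (k - i) * Ring.choose (y + s - i) (k - i)) else 0) =
      ∑ i ∈ Finset.range (y + 1 + k), if i ≤ k then (1 - c) ^ i * (y.choose i : ℤ) *
        (c ^ (k - i) * Ring.choose (y + s - i) (k - i)) else 0 := by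
    refine Finset.sum_subset (Finset.range_mono (by omega)) fun i _ hi => ?_
    rw [if_neg (by simpa using hi)]
  rw [h1, ← h2, ← Finset.sum_range_reflect]
  refine Finset.sum_congr rfl fun j hj => ?_
  have hj : j ≤ k := by simpa [Nat.lt_succ_iff] using hj
  rw [show k + 1 - 1 - j = k - j by omega, if_pos (by omega), Nat.sub_sub_self hj,
    Ring.choose_natCast, Nat.cast_sub hj, show (y : ℤ) + s - (k - j) = y + s - k + j by ring]
  ring

/-- The expansion in powers of `p + 1` and `-p`; it needs the exponent of `1 + X` to be a natural
number. -/
lemma coeff_separateSeries_eq_sum' (p : ℤ) (m k : ℕ) (n : ℤ)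
    (h : 0 ≤ n + m * p + m - p * k - 1) :
    coeff k (separateSeries p m n) =
      ∑ j ∈ Finset.range (k + 1), Ring.choose (n + m * p - (p + 1) * k + j) j
        * Ring.choose (n + m * p + m - p * k - 1) (k - j) * (p + 1) ^ j * (-p) ^ (k - j) := by
  lift n + m * p + m - p * k - 1 to ℕ using h with y hy
  rw [coeff_separateSeries, mul_comm p m, ← hy, coeff_one_mul_linearPow]
  refine Finset.sum_congr rfl fun j _ => ?_
  rw [hy, show n + m * p + m - p * k - 1 + (1 - m) - k + j = n + m * p - (p + 1) * k + j by ring,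
    show 1 - (p + 1) = -p by ring]

/-- The expansion obtained by taking the derivative, `k [X ^ k] φ = [X ^ (k-1)] φ'`. -/
lemma succ_mul_coeff_separateSeries (p : ℤ) (m k : ℕ) (n : ℤ) :
    ((k : ℤ) + 1) * coeff (k + 1) (separateSeries p m n) =
      ∑ j ∈ Finset.range (k + 1), (n - p * j) * Ring.choose ((m : ℤ) + j - 1) j
        * Ring.choose (n + m * p + m - p * (k + 1) - 1) (k - j) * (-p - 1) ^ j := by
  obtain ⟨y, hy⟩ : ∃ y, y = n + m * p + m - p * (k + 1) - 1 := ⟨_, rfl⟩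
  obtain ⟨e, he⟩ : ∃ e : ℤ, e = y - m * p - m + 1 + p := ⟨_, rfl⟩
  have hlhs : ((k : ℤ) + 1) * coeff (k + 1) (separateSeries p m n) =
      coeff k (derivative ℤ (linearPow 1 y * linearPow (p + 1) (1 - m))) := by
    rw [coeff_separateSeries, coeff_derivative, hy, mul_comm]
    congr 5
    push_cast
    ring
  have hrhs : ∑ j ∈ Finset.range (k + 1), (n - p * j) * Ring.choose ((m : ℤ) + j - 1) j
        * Ring.choose (n + m * p + m - p * (k + 1) - 1) (k - j) * (-p - 1) ^ j =
      coeff k (linearPow (p + 1) (-m) *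
        (C e * linearPow 1 y + C p * (X * derivative ℤ (linearPow 1 y)))) := by
    rw [coeff_mul, Finset.Nat.sum_antidiagonal_eq_sum_range_succ_mk]
    refine Finset.sum_congr rfl fun j hj => ?_
    have hj : j ≤ k := by simpa [Nat.lt_succ_iff] using hj
    have hX : ∀ i : ℕ, coeff i (X * derivative ℤ (linearPow 1 y)) =
        i * coeff i (linearPow 1 y) := by
      intro i
      cases i with
      | zero => simp
      | succ i => rw [coeff_succ_X_mul, coeff_derivative]; push_cast; ring
    simp only
    rw [← neg_pow_mul_choose, map_add, coeff_C_mul, coeff_C_mul, hX, coeff_linearPow, ← hy,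
      Nat.cast_sub hj, one_pow, one_mul, show -(p + 1) = -p - 1 by ring,
      show n - p * j = e + p * (k - j) by rw [he, hy]; ring]
    ring
  rw [hlhs, hrhs]
  congr 1
  rw [Derivation.leibniz, derivative_linearPow, derivative_linearPow, smul_eq_mul, smul_eq_mul,
    linearPow_eq_mul 1 y, linearPow_eq_mul (p + 1) (1 - m),
    show (1 : ℤ) - m - 1 = -m by ring, he]
  simp only [map_add, map_sub, map_mul, map_one, map_natCast, one_mul]
  ring

/-! ### Independence polynomials -/

/-- No two members of `A` are in the relation `r`, in either order. -/
def IsIndependent {V : Type*} (r : V → V → Prop) (A : Finset V) : Prop :=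
  ∀ a ∈ A, ∀ b ∈ A, ¬ r a b

open Classical in
/-- The independence polynomial of the relation `r` on `S`, as a power series: the `k`-th
coefficient counts the independent `k`-subsets of `S`. -/
noncomputable def indepSeries {V : Type*} (r : V → V → Prop) (S : Finset V) : ℤ⟦X⟧ :=
  ∑ A ∈ S.powerset with IsIndependent r A, X ^ A.card

open Classical in
lemma coeff_indepSeries {V : Type*} (r : V → V → Prop) (S : Finset V) (k : ℕ) :
    coeff k (indepSeries r S) =
      (((Finset.powersetCard k S).filter (IsIndependent r)).card : ℤ) := by
  rw [indepSeries, map_sum, Finset.card_filter, Nat.cast_sum, Finset.powersetCard_eq_filter]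
  simp only [coeff_X_pow, Finset.sum_filter, Nat.cast_ite, Nat.cast_one, Nat.cast_zero]
  refine Finset.sum_congr rfl fun A _ => ?_
  simp only [eq_comm (a := k)]
  split_ifs <;> rfl

lemma indepSeries_empty {V : Type*} (r : V → V → Prop) : indepSeries r ∅ = 1 := by
  classical
  simp only [indepSeries, Finset.powerset_empty]
  rw [Finset.filter_true_of_mem (by simp [IsIndependent])]
  simp

lemma indepSeries_image {V W : Type*} [DecidableEq W] (r : V → V → Prop) (s : W → W → Prop)
    (f : V → W) (S : Finset V) (hf : Set.InjOn f S)
    (h : ∀ a ∈ S, ∀ b ∈ S, (s (f a) (f b) ∨ s (f b) (f a) ↔ r a b ∨ r b a)) :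
    indepSeries s (S.image f) = indepSeries r S := by
  classical
  symm
  refine Finset.sum_bij (fun A _ => A.image f) ?_ ?_ ?_ ?_
  · intro A hA
    rw [Finset.mem_filter, Finset.mem_powerset] at hA ⊢
    refine ⟨Finset.image_subset_image hA.1, ?_⟩
    intro x hx y hy hxy
    obtain ⟨a, ha, rfl⟩ := Finset.mem_image.1 hx
    obtain ⟨b, hb, rfl⟩ := Finset.mem_image.1 hy
    rcases (h a (hA.1 ha) b (hA.1 hb)).1 (Or.inl hxy) with h | h
    · exact hA.2 a ha b hb h
    · exact hA.2 b hb a ha h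
  · intro A hA B hB hAB
    rw [Finset.mem_filter, Finset.mem_powerset] at hA hB
    have hAB : f '' A = f '' B := by
      rw [← Finset.coe_image, ← Finset.coe_image]; exact congrArg _ hAB
    exact_mod_cast (hf.image_eq_image_iff (by exact_mod_cast hA.1) (by exact_mod_cast hB.1)).1 hAB
  · intro B hB
    rw [Finset.mem_filter, Finset.mem_powerset, Finset.subset_image_iff] at hB
    obtain ⟨⟨A, hA, rfl⟩, hB⟩ := hB
    refine ⟨A, ?_, rfl⟩
    rw [Finset.mem_filter, Finset.mem_powerset]
    refine ⟨hA, fun a ha b hb hab => ?_⟩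
    have ha' := Finset.mem_image_of_mem f ha
    have hb' := Finset.mem_image_of_mem f hb
    rcases (h a (hA ha) b (hA hb)).2 (Or.inl hab) with h | h
    · exact hB _ ha' _ hb' h
    · exact hB _ hb' _ ha' h
  · intro A hA
    rw [Finset.mem_filter, Finset.mem_powerset] at hA
    rw [Finset.card_image_of_injOn (hf.mono (by exact_mod_cast hA.1))]

/-- The independent subsets of `insert v S` are those that avoid `v`, and those that contain `v`,
whose other members lie in the set `T` of elements of `S` unrelated to `v`. -/
lemma indepSeries_insert {V : Type*} [DecidableEq V] (r : V → V → Prop) (hr : ∀ a, ¬ r a a)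
    (S T : Finset V) (v : V) (hv : v ∉ S) (hT : ∀ a, a ∈ T ↔ a ∈ S ∧ ¬ r a v ∧ ¬ r v a) :
    indepSeries r (insert v S) = indepSeries r S + X * indepSeries r T := by
  classical
  have hTS : T ⊆ S := fun a ha => ((hT a).1 ha).1
  simp only [indepSeries, Finset.sum_filter, Finset.sum_powerset_insert hv]
  congr 1
  rw [← Finset.sum_filter, ← Finset.sum_filter, Finset.mul_sum]
  refine Finset.sum_congr ?_ fun A hA => ?_
  · ext A
    rw [Finset.mem_filter, Finset.mem_filter, Finset.mem_powerset, Finset.mem_powerset]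
    simp only [IsIndependent, Finset.mem_insert, forall_eq_or_imp, Finset.subset_iff, hT]
    constructor
    · rintro ⟨h1, h2, h3⟩
      exact ⟨fun a ha => ⟨h1 ha, (h3 a ha).1, h2.2 a ha⟩, fun a ha => (h3 a ha).2⟩
    · rintro ⟨h1, h2⟩
      exact ⟨fun a ha => (h1 ha).1, ⟨hr v, fun a ha => (h1 ha).2.2⟩,
        fun a ha => ⟨(h1 ha).2.1, h2 a ha⟩⟩
  · rw [Finset.mem_filter, Finset.mem_powerset] at hA
    rw [Finset.card_insert_of_notMem fun h => hv (hTS (hA.1 h)), pow_succ']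

lemma indepSeries_union {V : Type*} [DecidableEq V] (r : V → V → Prop) (hr : ∀ a, ¬ r a a)
    (S T : Finset V) (hd : Disjoint S T) (h : ∀ a ∈ S, ∀ b ∈ T, ¬ r a b ∧ ¬ r b a) :
    indepSeries r (S ∪ T) = indepSeries r S * indepSeries r T := by
  classical
  induction T using Finset.strongInduction with
  | H T ih =>
    rcases T.eq_empty_or_nonempty with rfl | ⟨v, hv⟩
    · simp [indepSeries_empty]
    · obtain ⟨U, hvU, rfl⟩ : ∃ U, v ∉ U ∧ insert v U = T :=
        ⟨T.erase v, Finset.notMem_erase v T, Finset.insert_erase hv⟩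
      have hvS : v ∉ S := fun hS => Finset.disjoint_left.1 hd hS hv
      have hd' : Disjoint S U := hd.mono_right (Finset.subset_insert v U)
      have hlt := Finset.ssubset_insert hvU
      set W := U.filter fun a => ¬ r a v ∧ ¬ r v a with hW
      have hWU : W ⊆ U := Finset.filter_subset _ U
      rw [Finset.union_insert,
        indepSeries_insert r hr (S ∪ U) (S ∪ W) v (by simp [hvS, hvU]) (fun a => ?_),
        indepSeries_insert r hr U W v hvU (fun a => by rw [hW, Finset.mem_filter]),
        ih U hlt hd' fun a ha b hb => h a ha b (Finset.mem_insert_of_mem hb),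
        ih W (hWU.trans_ssubset hlt) (hd'.mono_right hWU)
          fun a ha b hb => h a ha b (Finset.mem_insert_of_mem (hWU hb))]
      · ring
      · rw [Finset.mem_union, Finset.mem_union, hW, Finset.mem_filter]
        have := fun ha => h a ha v hv
        tauto

/-- If related elements have the same colour, the colour classes contribute independently. -/
lemma indepSeries_filter_mem_eq_prod {V ι : Type*} [DecidableEq V] [DecidableEq ι]
    (r : V → V → Prop) (hr : ∀ a, ¬ r a a) (c : V → ι) (hc : ∀ a b, r a b → c a = c b)
    (S : Finset V) (I : Finset ι) :
    indepSeries r (S.filter fun a => c a ∈ I) =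
      ∏ i ∈ I, indepSeries r (S.filter fun a => c a = i) := by
  induction I using Finset.induction_on with
  | empty => simp [indepSeries_empty]
  | insert i I hi ih =>
    rw [Finset.prod_insert hi, ← ih]
    simp only [Finset.mem_insert, Finset.filter_or]
    refine indepSeries_union r hr _ _ ?_ ?_
    · rw [Finset.disjoint_filter]
      rintro a _ rfl
      exact hi
    · intro a ha b hb
      rw [Finset.mem_filter] at ha hb
      refine ⟨fun hab => hi ?_, fun hab => hi ?_⟩
      · rw [← ha.2, hc a b hab]; exact hb.2
      · rw [← ha.2, ← hc b a hab]; exact hb.2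

lemma indepSeries_eq_prod {V : Type*} [DecidableEq V]
    (r : V → V → Prop) (hr : ∀ a, ¬ r a a) (c : V → ℕ) (hc : ∀ a b, r a b → c a = c b)
    (S : Finset V) (m : ℕ) (hm : ∀ a ∈ S, c a < m) :
    indepSeries r S = ∏ i ∈ Finset.range m, indepSeries r (S.filter fun a => c a = i) := by
  rw [← indepSeries_filter_mem_eq_prod r hr c hc,
    Finset.filter_true_of_mem fun a ha => Finset.mem_range.2 (hm a ha)]

/-- The coefficients of a product up to degree `k` depend only on those of the factors up to
degree `k`; the counts agree with the coefficients of `separateSeries` in this range only. -/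
lemma coeff_prod_congr {ι : Type*} (s : Finset ι) (f g : ι → ℤ⟦X⟧) (k : ℕ)
    (h : ∀ i ∈ s, ∀ j ≤ k, coeff j (f i) = coeff j (g i)) :
    ∀ j ≤ k, coeff j (∏ i ∈ s, f i) = coeff j (∏ i ∈ s, g i) := by
  classical
  induction s using Finset.induction_on with
  | empty => simp
  | insert i s hi ih =>
    intro j hj
    rw [Finset.prod_insert hi, Finset.prod_insert hi, coeff_mul, coeff_mul]
    refine Finset.sum_congr rfl fun x hx => ?_
    rw [Finset.HasAntidiagonal.mem_antidiagonal] at hx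
    rw [h i (Finset.mem_insert_self i s) _ (by omega),
      ih (fun i' hi' => h i' (Finset.mem_insert_of_mem hi')) _ (by omega)]

/-! ### Forbidden steps `1, …, p` on a line and on a circle -/

/-- Positions `a < b` on a line whose difference is one of `m, 2m, …, pm`. -/
def LineConflict (m p a b : ℕ) : Prop := a < b ∧ ∃ i, 1 ≤ i ∧ i ≤ p ∧ b = a + i * m

/-- Positions `a ≠ b` on a circle of length `n` such that `b` is reached from `a` by going forward
one of `m, 2m, …, pm` steps. -/
def CircleConflict (n m p a b : ℕ) : Prop :=
  a ≠ b ∧ ∃ i, 1 ≤ i ∧ i ≤ p ∧ b ≡ a + i * m [MOD n]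

lemma lineConflict_one_iff (p a b : ℕ) : LineConflict 1 p a b ↔ a < b ∧ b ≤ a + p := by
  constructor
  · rintro ⟨h, i, h1, h2, h3⟩; omega
  · rintro ⟨h, h'⟩; exact ⟨h, b - a, by omega, by omega, by omega⟩

lemma not_lineConflict_self (m p a : ℕ) : ¬ LineConflict m p a a := fun h => h.1.false

lemma not_circleConflict_self (n m p a : ℕ) : ¬ CircleConflict n m p a a := fun h => h.1 rfl

lemma indepSeries_line_succ (p N : ℕ) :
    indepSeries (LineConflict 1 p) (Finset.range (N + 1)) =
      indepSeries (LineConflict 1 p) (Finset.range N) +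
        X * indepSeries (LineConflict 1 p) (Finset.range (N - p)) := by
  classical
  rw [Finset.range_add_one]
  refine indepSeries_insert _ (not_lineConflict_self 1 p) _ _ _ (by simp) fun a => ?_
  simp only [Finset.mem_range, lineConflict_one_iff]
  omega

/-- The subtraction is truncated. For `N + p < p * k` one has `k ≥ 2`, so that the right side is
`choose 0 k = 0`, and indeed there are no such subsets. -/
lemma coeff_indepSeries_line (p N k : ℕ) :
    coeff k (indepSeries (LineConflict 1 p) (Finset.range N)) = ((N + p - p * k).choose k : ℤ) := by
  induction N using Nat.strong_induction_on generalizing k with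
  | _ N ih =>
    cases N with
    | zero =>
      rw [Finset.range_zero, indepSeries_empty, coeff_one]
      cases k with
      | zero => simp
      | succ k => simp [mul_add]
    | succ N =>
      rw [indepSeries_line_succ, map_add, ih N (by omega)]
      cases k with
      | zero => simp
      | succ k =>
        rw [coeff_succ_X_mul, ih (N - p) (by omega), mul_add, mul_one]
        rcases Nat.lt_or_ge N (p * k) with h | h
        · obtain ⟨k, rfl⟩ : ∃ j, k = j + 1 := ⟨k - 1, by
            rcases k with _ | k <;> simp_all⟩
          rw [mul_add, mul_one] at h ⊢
          rw [show N + 1 + p - (p * k + p + p) = 0 by omega,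
            show N + p - (p * k + p + p) = 0 by omega,
            show N - p + p - (p * k + p) = 0 by omega]
          simp
        · rw [show N + 1 + p - (p * k + p) = N - p * k + 1 by omega,
            show N + p - (p * k + p) = N - p * k by omega, Nat.choose_succ_succ]
          rcases k with _ | k
          · simp [add_comm]
          · have : p ≤ N := by rw [mul_add] at h; omega
            rw [show N - p + p = N by omega]
            push_cast
            ring

lemma circleConflict_one_iff (p N a b : ℕ) (hp : p < N) (hab : a < b) (hb : b < N) :
    CircleConflict N 1 p a b ∨ CircleConflict N 1 p b a ↔ b ≤ a + p ∨ a + N ≤ b + p := by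
  constructor
  · rintro (⟨-, i, h1, h2, h3⟩ | ⟨-, i, h1, h2, h3⟩)
    · left
      rw [mul_one, Nat.ModEq.comm, Nat.modEq_iff_dvd] at h3
      obtain ⟨c, hc⟩ := h3
      push_cast at hc
      have : c = 0 := by
        have h1 : c < 1 := by by_contra! h; nlinarith
        have h2 : -1 < c := by by_contra! h; nlinarith
        omega
      subst this
      omega
    · right
      rw [mul_one, Nat.ModEq.comm, Nat.modEq_iff_dvd] at h3
      obtain ⟨c, hc⟩ := h3
      push_cast at hc
      have : c = -1 := by
        have h1 : c < 0 := by by_contra! h; nlinarith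
        have h2 : -2 < c := by by_contra! h; nlinarith
        omega
      subst this
      omega
  · rintro (h | h)
    · exact Or.inl ⟨hab.ne, b - a, by omega, by omega, by
        rw [mul_one, Nat.add_sub_cancel' hab.le]⟩
    · refine Or.inr ⟨hab.ne', a + N - b, by omega, by omega, ?_⟩
      rw [mul_one, Nat.add_sub_cancel' (by omega)]
      simp [Nat.ModEq]

/-- The circle is built from the line of the first `N - p` positions by adding the last `p`
positions one at a time: an independent set contains at most one of these, and then the rest
of it lies on a line of `N - 2p - 1` positions. -/
lemma indepSeries_circle_one_aux (p N t : ℕ) (hN : p < N) (ht : t ≤ p) :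
    indepSeries (CircleConflict N 1 p) (Finset.range (N - p + t)) =
      indepSeries (LineConflict 1 p) (Finset.range (N - p)) +
        C (t : ℤ) * (X * indepSeries (LineConflict 1 p) (Finset.range (N - 2 * p - 1))) := by
  classical
  -- on an arc whose complement has at least `p` positions, circle and line agree
  have arc : ∀ s l : ℕ, s + l ≤ N → l + p ≤ N →
      indepSeries (CircleConflict N 1 p) ((Finset.range l).image (s + ·)) =
        indepSeries (LineConflict 1 p) (Finset.range l) := by
    intro s l h1 h2
    refine indepSeries_image _ _ _ _ (fun a _ b _ h => by simpa using h) ?_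
    intro a ha b hb
    rw [Finset.mem_range] at ha hb
    rw [lineConflict_one_iff, lineConflict_one_iff]
    rcases lt_trichotomy a b with hab | rfl | hab
    · rw [circleConflict_one_iff p N _ _ hN (by simpa using hab) (by omega)]
      omega
    · simp [not_circleConflict_self]
    · rw [or_comm, circleConflict_one_iff p N _ _ hN (by simpa using hab) (by omega)]
      omega
  induction t with
  | zero =>
    have := arc 0 (N - p) (by omega) (by omega)
    simpa using this
  | succ t ih =>
    rw [← add_assoc, Finset.range_add_one,
      indepSeries_insert _ (not_circleConflict_self N 1 p) _
        ((Finset.range (N - 2 * p - 1)).image (t + 1 + ·)) _ (by simp), ih (by omega),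
      arc (t + 1) (N - 2 * p - 1) (by omega) (by omega)]
    · simp only [Nat.cast_add, Nat.cast_one, map_add, map_one]
      ring
    · intro a
      rw [Finset.mem_range, Finset.mem_image, ← not_or]
      constructor
      · rintro ⟨b, hb, rfl⟩
        rw [Finset.mem_range] at hb
        rw [circleConflict_one_iff p N _ _ hN (by omega) (by omega)]
        omega
      · rintro ⟨h1, h2⟩
        rw [circleConflict_one_iff p N _ _ hN h1 (by omega)] at h2
        exact ⟨a - (t + 1), by rw [Finset.mem_range]; omega, by omega⟩

lemma indepSeries_circle_one (p N : ℕ) (hN : p < N) :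
    indepSeries (CircleConflict N 1 p) (Finset.range N) =
      indepSeries (LineConflict 1 p) (Finset.range (N - p)) +
        C (p : ℤ) * (X * indepSeries (LineConflict 1 p) (Finset.range (N - 2 * p - 1))) := by
  rw [← indepSeries_circle_one_aux p N p hN le_rfl, Nat.sub_add_cancel hN.le]

lemma coeff_line_eq_separateSeries (p N k : ℕ) (h : p * k ≤ N + p) :
    coeff k (indepSeries (LineConflict 1 p) (Finset.range N)) =
      coeff k (separateSeries p 1 N) := by
  rw [coeff_indepSeries_line, coeff_separateSeries_one, ← Ring.choose_natCast, Nat.cast_sub h]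
  push_cast
  rfl

lemma coeff_circle_one_eq_separateSeries (p N k : ℕ) (hN : p < N) (h : p * k < N) :
    coeff k (indepSeries (CircleConflict N 1 p) (Finset.range N)) =
      coeff k (separateSeries p 0 N) := by
  rw [indepSeries_circle_one p N hN, map_add, coeff_C_mul]
  cases k with
  | zero => simp [coeff_indepSeries_line, coeff_zero_separateSeries,
      coeff_zero_X_mul, -coeff_zero_eq_constantCoeff]
  | succ k =>
    rw [coeff_succ_X_mul, coeff_indepSeries_line, coeff_indepSeries_line,
      coeff_succ_separateSeries_zero, ← Ring.choose_natCast, ← Ring.choose_natCast]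
    congr 2
    · rw [Nat.cast_sub (by omega)]
      push_cast [hN.le]
      ring
    · rcases k with _ | k
      · simp
      · congr 1
        rw [mul_add, mul_add] at h
        rw [Nat.cast_sub (by rw [mul_add]; omega)]
        push_cast [show 2 * p + 1 ≤ N by omega, Nat.sub_sub]
        ring

/-! ### Splitting along steps of length `m` -/

/-- For `i ≥ n` the truncated subtraction makes the range on the right empty, as it should be. -/
lemma range_filter_mod_eq (n m i : ℕ) (hi : i < m) :
    ((Finset.range n).filter fun a => a % m = i) =
      (Finset.range ((n - i + m - 1) / m)).image fun q => i + q * m := by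
  ext a
  rw [Finset.mem_filter, Finset.mem_range, Finset.mem_image]
  have key : ∀ q, q ∈ Finset.range ((n - i + m - 1) / m) ↔ i + q * m < n := by
    intro q
    rw [Finset.mem_range, Nat.lt_iff_add_one_le, Nat.le_div_iff_mul_le (by omega), add_mul]
    omega
  constructor
  · rintro ⟨h1, h2⟩
    have h3 : i + a / m * m = a := by rw [← h2, mul_comm]; exact Nat.mod_add_div a m
    exact ⟨a / m, by rw [key, h3]; exact h1, h3⟩
  · rintro ⟨q, hq, rfl⟩
    exact ⟨(key q).1 hq, by rw [Nat.add_mul_mod_self_right, Nat.mod_eq_of_lt hi]⟩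

lemma indepSeries_line_eq_prod (n m p : ℕ) (hm : 1 ≤ m) :
    indepSeries (LineConflict m p) (Finset.range n) =
      ∏ i ∈ Finset.range m,
        indepSeries (LineConflict 1 p) (Finset.range ((n - i + m - 1) / m)) := by
  rw [indepSeries_eq_prod _ (not_lineConflict_self m p) (· % m) _ _ m
    fun a _ => Nat.mod_lt a hm]
  · refine Finset.prod_congr rfl fun i hi => ?_
    rw [range_filter_mod_eq n m i (Finset.mem_range.1 hi)]
    have key : ∀ a b, LineConflict m p (i + a * m) (i + b * m) ↔ LineConflict 1 p a b := by
      intro a b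
      simp only [LineConflict, add_lt_add_iff_left, Nat.mul_lt_mul_right hm, add_assoc,
        Nat.add_left_cancel_iff, ← add_mul, Nat.mul_left_inj (show m ≠ 0 by omega), mul_one]
    refine indepSeries_image _ _ _ _ (fun a _ b _ h => ?_) fun a _ b _ => by rw [key, key]
    simpa [show m ≠ 0 by omega] using h
  · rintro a b ⟨-, i, -, -, rfl⟩
    simp

lemma sum_card_residue_classes (n m : ℕ) (hm : 1 ≤ m) :
    ∑ i ∈ Finset.range m, (n - i + m - 1) / m = n := by
  conv_rhs => rw [← Finset.card_range n]
  rw [Finset.card_eq_sum_card_fiberwise (f := (· % m)) (t := Finset.range m)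
    fun a _ => by simpa using Nat.mod_lt a hm]
  refine Finset.sum_congr rfl fun i hi => ?_
  rw [range_filter_mod_eq n m i (Finset.mem_range.1 hi), Finset.card_image_of_injective,
    Finset.card_range]
  intro a b h
  simpa [show m ≠ 0 by omega] using h

lemma coeff_indepSeries_lineConflict (p m n k : ℕ) (hm : 1 ≤ m) (h : p * m * (k - 1) ≤ n) :
    coeff k (indepSeries (LineConflict m p) (Finset.range n)) =
      coeff k (separateSeries p m n) := by
  rw [indepSeries_line_eq_prod n m p hm]
  conv_rhs => rw [← sum_card_residue_classes n m hm, Nat.cast_sum, ← prod_separateSeries_one]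
  refine coeff_prod_congr _ _ _ k (fun i hi j hj => ?_) k le_rfl
  rw [Finset.mem_range] at hi
  apply coeff_line_eq_separateSeries
  -- the shortest class still has at least `p (k - 1)` positions
  have h1 : p * (k - 1) ≤ (n - i + m - 1) / m := by
    rw [Nat.le_div_iff_mul_le hm, mul_right_comm]
    omega
  calc p * j ≤ p * (k - 1 + 1) := Nat.mul_le_mul_left p (by omega)
    _ ≤ (n - i + m - 1) / m + p := by rw [mul_add, mul_one]; omega

/-- Going round a circle of length `n` in steps of `m` decomposes it into `gcd n m` circles of
length `n / gcd n m`. -/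
lemma indepSeries_circle_eq_pow (n m p : ℕ) (hn : 0 < n) :
    indepSeries (CircleConflict n m p) (Finset.range n) =
      indepSeries (CircleConflict (n / n.gcd m) 1 p) (Finset.range (n / n.gcd m)) ^ n.gcd m := by
  set d := n.gcd m with hd
  set N := n / d with hN
  have hd0 : 0 < d := Nat.gcd_pos_of_pos_left m hn
  have hdn : N * d = n := Nat.div_mul_cancel (Nat.gcd_dvd_left n m)
  have hdm : d ∣ m := Nat.gcd_dvd_right n m
  have cancel : ∀ a b : ℕ, a * m ≡ b * m [MOD n] ↔ a ≡ b [MOD N] := by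
    intro a b
    refine ⟨fun h => Nat.ModEq.cancel_right_div_gcd hn h, fun h => ?_⟩
    obtain ⟨e, he⟩ := hdm
    rw [he, ← hdn, ← mul_assoc, ← mul_assoc, mul_right_comm a, mul_right_comm b]
    exact (h.mul_right e).mul_right' d
  rw [indepSeries_eq_prod _ (not_circleConflict_self n m p) (· % d) _ _ d
    fun a _ => Nat.mod_lt a hd0]
  · conv_rhs => rw [← Finset.card_range d, ← Finset.prod_const]
    refine Finset.prod_congr rfl fun i hi => ?_
    rw [Finset.mem_range] at hi
    have hinj : ∀ a b : ℕ, i + a * m ≡ i + b * m [MOD n] ↔ a ≡ b [MOD N] := fun a b => by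
      rw [← cancel]
      exact ⟨fun h => h.add_left_cancel', fun h => h.add_left i⟩
    have hinjOn : Set.InjOn (fun q => (i + q * m) % n) (Finset.range N) := by
      intro a ha b hb h
      exact ((hinj a b).1 h).eq_of_lt_of_lt (by simpa using ha) (by simpa using hb)
    have himage : ((Finset.range n).filter fun a => a % d = i) =
        (Finset.range N).image fun q => (i + q * m) % n := by
      symm
      -- the image lies in the residue class, and both have `N` elements
      apply Finset.eq_of_subset_of_card_le
      · intro a ha
        obtain ⟨q, -, rfl⟩ := Finset.mem_image.1 ha
        rw [Finset.mem_filter, Finset.mem_range]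
        refine ⟨Nat.mod_lt _ hn, ?_⟩
        rw [Nat.mod_mod_of_dvd _ (Nat.gcd_dvd_left n m), ← Nat.mod_eq_of_lt hi]
        have : d ∣ q * m := hdm.mul_left q
        rw [Nat.add_mod, Nat.mod_eq_zero_of_dvd this, add_zero, Nat.mod_mod, Nat.mod_mod]
      · rw [Finset.card_image_of_injOn hinjOn, range_filter_mod_eq n d i hi]
        refine Finset.card_image_le.trans ?_
        rw [Finset.card_range, Finset.card_range, ← Nat.lt_succ_iff, Nat.div_lt_iff_lt_mul hd0,
          Nat.succ_mul, hdn]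
        omega
    rw [himage]
    have key : ∀ a ∈ Finset.range N, ∀ b ∈ Finset.range N,
        (CircleConflict n m p ((i + a * m) % n) ((i + b * m) % n) ↔
          CircleConflict N 1 p a b) := by
      intro a ha b hb
      refine and_congr (not_congr ⟨fun h => hinjOn ha hb h, fun h => by rw [h]⟩)
        (exists_congr fun t => and_congr_right fun _ => and_congr_right fun _ => ?_)
      rw [← hinj, mul_one, add_mul, ← add_assoc]
      exact ⟨fun h => ((Nat.mod_modEq _ n).symm.trans h).trans ((Nat.mod_modEq _ n).add_right _),
        fun h => ((Nat.mod_modEq _ n).trans h).trans ((Nat.mod_modEq _ n).symm.add_right _)⟩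
    exact indepSeries_image _ _ _ _ hinjOn fun a ha b hb => by rw [key a ha b hb, key b hb a ha]
  · rintro a b ⟨-, i, -, -, h⟩
    have h := h.of_dvd (Nat.gcd_dvd_left n m)
    have : d ∣ i * m := hdm.mul_left i
    rw [show b % d = (a + i * m) % d from h, Nat.add_mod, Nat.mod_eq_zero_of_dvd this, add_zero,
      Nat.mod_mod]

lemma coeff_indepSeries_circleConflict (p m n k : ℕ) (hm : 1 ≤ m) (hk : 1 ≤ k)
    (h : m * p * k + 1 ≤ n) :
    coeff k (indepSeries (CircleConflict n m p) (Finset.range n)) =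
      coeff k (separateSeries p 0 n) := by
  have hdn : n / n.gcd m * n.gcd m = n := Nat.div_mul_cancel (Nat.gcd_dvd_left n m)
  have hN : p * k < n / n.gcd m := by
    have hd : n.gcd m ≤ m := Nat.gcd_le_right n hm
    by_contra! hcon
    have : n ≤ m * p * k := by
      calc n = n / n.gcd m * n.gcd m := hdn.symm
        _ ≤ p * k * m := Nat.mul_le_mul hcon hd
        _ = m * p * k := by ring
    omega
  have hpN : p < n / n.gcd m := lt_of_le_of_lt (Nat.le_mul_of_pos_right p hk) hN
  rw [indepSeries_circle_eq_pow n m p (by omega)]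
  conv_rhs => rw [← hdn, mul_comm, Nat.cast_mul, ← separateSeries_zero_pow]
  rw [← Finset.card_range (n.gcd m), ← Finset.prod_const, ← Finset.prod_const]
  rw [Finset.card_range]
  exact coeff_prod_congr _ _ _ k (fun i _ j hj => coeff_circle_one_eq_separateSeries p _ j hpN
    (lt_of_le_of_lt (Nat.mul_le_mul_left p hj) hN)) k le_rfl

/-! ### The counts as coefficients -/

lemma indepSeries_univ_fin {n : ℕ} (r : ℕ → ℕ → Prop) :
    indepSeries (fun a b : Fin n => r a b) Finset.univ = indepSeries r (Finset.range n) := by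
  have : Finset.range n = (Finset.univ : Finset (Fin n)).image Fin.val := by
    ext a
    simp only [Finset.mem_range, Finset.mem_image, Finset.mem_univ, true_and]
    exact ⟨fun h => ⟨⟨a, h⟩, rfl⟩, by rintro ⟨b, rfl⟩; exact b.2⟩
  rw [this]
  exact (indepSeries_image _ _ _ _ Fin.val_injective.injOn fun _ _ _ _ => Iff.rfl).symm

lemma isLineSeparate_iff {p m n : ℕ} (hm : 1 ≤ m) (A : Finset (Fin n)) :
    IsLineSeparate (admissibleGaps m p) A ↔
      IsIndependent (fun a b : Fin n => LineConflict m p a b) A := by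
  refine forall₂_congr fun a _ => forall₂_congr fun b _ => ?_
  simp only [LineConflict, admissibleGaps, Set.mem_ofPred_eq, Fin.card_Ioo, not_and, not_exists]
  rw [Fin.lt_def]
  refine forall_congr' fun hab => forall_congr' fun i => ?_
  refine forall_congr' fun hi => forall_congr' fun _ => not_congr ?_
  have : 1 ≤ i * m := Nat.mul_pos hi hm
  omega

lemma isCircleSeparate_iff {p m n : ℕ} (hm : 1 ≤ m) (hn : p * m < n) (A : Finset (Fin n)) :
    IsCircleSeparate (admissibleGaps m p) A ↔
      IsIndependent (fun a b : Fin n => CircleConflict n m p a b) A := by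
  refine forall₂_congr fun a _ => forall₂_congr fun b _ => ?_
  simp only [CircleConflict, admissibleGaps, Set.mem_ofPred_eq, not_and, not_exists]
  rw [Ne, Fin.ext_iff]
  refine forall_congr' fun hab => forall_congr' fun i => ?_
  refine forall_congr' fun hi => forall_congr' fun hip => not_congr ?_
  have h1 : 1 ≤ i * m := Nat.mul_pos hi hm
  have h2 : i * m < n := lt_of_le_of_lt (Nat.mul_le_mul_right m hip) hn
  have ha := a.2
  have hb := b.2
  rw [arcCount]
  have hmod : ((b : ℕ) ≡ a + i * m [MOD n]) ↔ (b : ℕ) = a + i * m ∨ b + n = a + i * m := by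
    rw [Nat.ModEq, Nat.mod_eq_of_lt hb]
    rcases Nat.lt_or_ge (a + i * m) n with h | h
    · rw [Nat.mod_eq_of_lt h]; omega
    · rw [Nat.mod_eq_sub_mod h, Nat.mod_eq_of_lt (by omega)]; omega
  rw [hmod]
  split_ifs with h <;> rw [Fin.lt_def] at h
  · rw [Fin.card_Ioo]; omega
  · rw [Fin.card_Ioi, Fin.card_Iio]; omega

lemma lineCount_eq_coeff (p m n k : ℕ) (hm : 1 ≤ m) (h : p * m * (k - 1) ≤ n) :
    (lineCount p m n k : ℤ) = coeff k (separateSeries p m n) := by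
  rw [← coeff_indepSeries_lineConflict p m n k hm h, ← indepSeries_univ_fin, coeff_indepSeries,
    lineCount]
  congr! 3
  exact isLineSeparate_iff hm _

lemma circleCount_eq_coeff (p m n k : ℕ) (hm : 1 ≤ m) (hk : 1 ≤ k) (h : m * p * k + 1 ≤ n) :
    (circleCount p m n k : ℤ) = coeff k (separateSeries p 0 n) := by
  have hn : p * m < n := by
    calc p * m = m * p * 1 := by ring
      _ ≤ m * p * k := Nat.mul_le_mul_left _ hk
      _ < n := h
  rw [← coeff_indepSeries_circleConflict p m n k hm hk h, ← indepSeries_univ_fin,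
    coeff_indepSeries, circleCount]
  congr! 3
  exact isCircleSeparate_iff hm hn _

theorem mainTheorem1 (p m k : ℕ) (hp : 1 ≤ p) (hm : 1 ≤ m) (hk : 1 ≤ k) :
    (∀ n : ℕ, p * m * (k - 1) ≤ n →
      (lineCount p m n k : ℤ) =
        ∑ j ∈ Finset.range (k + 1),
          Ring.choose ((m : ℤ) + j - 2) j
            * Ring.choose ((n : ℤ) + m * p + m - p * k - 1) (k - j)
            * (-(p : ℤ) - 1) ^ j ∧
      (lineCount p m n k : ℤ) =
        ∑ j ∈ Finset.range (k + 1),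
          Ring.choose ((n : ℤ) + m * p - (p + 1) * k + j) j
            * Ring.choose ((n : ℤ) + m * p + m - p * k - 1) (k - j)
            * ((p : ℤ) + 1) ^ j * (-(p : ℤ)) ^ (k - j) ∧
      (lineCount p m n k : ℚ) =
        ∑ j ∈ Finset.range k,
          (((n : ℚ) - p * j) / k)
            * ((Ring.choose ((m : ℤ) + j - 1) j : ℤ) : ℚ)
            * ((Ring.choose ((n : ℤ) + m * p + m - p * k - 1) (k - 1 - j) : ℤ) : ℚ)
            * (-(p : ℚ) - 1) ^ j) ∧
    (∀ n : ℕ, m * p * k + 1 ≤ n →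
      (circleCount p m n k : ℚ) =
        ((n : ℚ) / ((n : ℚ) - p * k)) * ((Ring.choose ((n : ℤ) - p * k) k : ℤ) : ℚ)) := by
  refine ⟨fun n hn => ?_, fun n hn => ?_⟩
  · have hcount := lineCount_eq_coeff p m n k hm hn
    refine ⟨?_, ?_, ?_⟩
    · rw [hcount, coeff_separateSeries_eq_sum]
    · rw [hcount, coeff_separateSeries_eq_sum']
      -- `n + mp + m - pk - 1 ≥ (m - 1) (pk + 1) ≥ 0`, since `n ≥ pm (k - 1)`
      obtain ⟨k, rfl⟩ : ∃ j, k = j + 1 := ⟨k - 1, by omega⟩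
      obtain ⟨m, rfl⟩ : ∃ j, m = j + 1 := ⟨m - 1, by omega⟩
      rw [Nat.add_sub_cancel] at hn
      zify at hn
      push_cast
      have : (0 : ℤ) ≤ p * m * k := by positivity
      have : (0 : ℤ) ≤ m * p := by positivity
      nlinarith
    · obtain ⟨k, rfl⟩ : ∃ j, k = j + 1 := ⟨k - 1, by omega⟩
      have h := succ_mul_coeff_separateSeries p m k n
      rw [← hcount] at h
      have h := congrArg (Int.cast (R := ℚ)) h
      push_cast at h
      have hk0 : (k : ℚ) + 1 ≠ 0 := by positivity
      apply mul_left_cancel₀ hk0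
      rw [h, Finset.mul_sum]
      refine Finset.sum_congr rfl fun j _ => ?_
      rw [Nat.add_sub_cancel]
      push_cast
      field_simp
  · have h := mul_coeff_separateSeries_zero p n k
    rw [← circleCount_eq_coeff p m n k hm hk hn] at h
    have h := congrArg (Int.cast (R := ℚ)) h
    push_cast at h
    have hpos : (0 : ℚ) < n - p * k := by
      have : p * k < n := by
        calc p * k = 1 * (p * k) := (one_mul _).symm
          _ ≤ m * (p * k) := Nat.mul_le_mul_right _ hm
          _ = m * p * k := by ring
          _ < n := hn
      rw [sub_pos]
      exact_mod_cast this
    rw [div_mul_eq_mul_div, eq_div_iff hpos.ne', mul_comm, h]
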